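/- Let $m\ge 0$, let $C$ be a symmetric $m\times m$ matrix with integer entries, and let $n_1,\dots,n_m$ be nonnegative integers. For $(q;q)_d=\prod_{k=1}^d(1-q^k)$ consider the formal power series $$P_C(x_1,\dots,x_m)=\sum_{d_1,\dots,d_m\ge 0}\frac{(-q^{1/2})^{\sum_{i,j=1}^m C_{i,j}d_id_j}}{(q;q)_{d_1}\cdots(q;q)_{d_m}}\,x_1^{d_1}\cdots x_m^{d_m}\qquad (q>0,\ q\ne 1).$$ Then the limit $$y(x_1,\dots,x_m)=\lim_{q\to1}\frac{P_C(q^{n_1}x_1,\dots,q^{n_m}x_m)}{P_C(x_1,\dots,x_m)}=\sum_{l_1,\dots,l_m\ge 0}b_{l_1,\dots,l_m}x_1^{l_1}\cdots x_m^{l_m}$$ exists coefficient by coefficient, and $$b_{l_1,\dots,l_m}=(-1)^{\sum_{i=1}^m(C_{i,i}+1)l_i}\,A(l_1,\dots,l_m)\prod_{j=1}^m\frac{1}{n_j+\sum_{i=1}^mC_{i,j}l_i}\binom{n_j+\sum_{i=1}^mC_{i,j}l_i}{l_j},$$ where $\binom{a}{k}=a(a-1)\cdots(a-k+1)/k!$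 and $$A(l_1,\dots,l_m)=n_1\cdots n_m\Bigl(1+\sum_{k=1}^{m-1}\ \sum_{\Sigma_k}\ \prod_{(i,j)\in\Sigma_k}C_{i,j}\,l_i\,n_j^{-1}\Bigr).$$ The inner sum runs over all admissible sets $\Sigma_k$ of $k$ pairs $(i,j)$ with $1\le i,j\le m$. A set of pairs is admissible if no two distinct pairs in it have the same second entry and it contains no cycle, that is, no distinct pairs $(i_1,j_1),\dots,(i_r,j_r)$, $r\ge1$, with $j_t=i_{t+1}$ for $1\le t<r$ and $j_r=i_1$. The formula for $b_{l_1,\dots,l_m}$ holds as it stands whenever all $n_j$ and all $n_j+\sum_iC_{i,j}l_i$ are nonzero. In general it is understood as follows: for fixed $C$ and $l_1,\dots,l_m$, the right-hand side, with $n_1,\dots,n_m$ regarded as indeterminates, is a polynomial in $\mathbb{Q}[n_1,\dots,n_m]$, and $b_{l_1,\dots,l_m}$ is the value of this polynomial at the given levels. -/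

import Mathlib

open scoped Topology

/-- The `q`-Pochhammer symbol `(q;q)_d = (1 - q)(1 - q²)⋯(1 - q^d)`. -/
noncomputable def qPoch (q : ℝ) (d : ℕ) : ℝ :=
  ∏ k ∈ Finset.range d, (1 - q ^ (k + 1))

/-- The quiver generating series
`P_C(x₁,…,x_m) = ∑_d (-q^{1/2})^{∑_{i,j} C_{ij} d_i d_j} / ((q;q)_{d₁}⋯(q;q)_{d_m}) x^d`,
a formal power series in `x₁,…,x_m`, for a real value of `q` (used for `q > 0`, `q ≠ 1`). -/
noncomputable def quiverSeries {m : ℕ} (C : Matrix (Fin m) (Fin m) ℤ) (q : ℝ) :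
    MvPowerSeries (Fin m) ℝ :=
  fun d => (-Real.sqrt q) ^ (∑ i, ∑ j, C i j * (d i : ℤ) * (d j : ℤ)) / ∏ i, qPoch q (d i)

/-- The quotient `P_C(q^{n₁} x₁,…,q^{n_m} x_m) / P_C(x₁,…,x_m)` of formal power series
(the denominator has constant coefficient `1`). -/
noncomputable def quiverQuotient {m : ℕ} (C : Matrix (Fin m) (Fin m) ℤ) (n : Fin m → ℕ) (q : ℝ) :
    MvPowerSeries (Fin m) ℝ :=
  MvPowerSeries.rescale (fun i => q ^ n i) (quiverSeries C q) * (quiverSeries C q)⁻¹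

/-- `y = lim_{q → 1} P_C(q^{n₁} x₁,…,q^{n_m} x_m) / P_C(x₁,…,x_m)`, coefficient by coefficient. -/
def IsClassicalLimit {m : ℕ} (C : Matrix (Fin m) (Fin m) ℤ) (n : Fin m → ℕ)
    (y : MvPowerSeries (Fin m) ℝ) : Prop :=
  ∀ l : Fin m →₀ ℕ, Filter.Tendsto (fun q : ℝ => MvPowerSeries.coeff l (quiverQuotient C n q))
    (𝓝[≠] 1) (𝓝 (MvPowerSeries.coeff l y))

/-- A set `S` of pairs `(i, j)` is admissible if distinct pairs have distinct second entries, and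
there is no cycle: no distinct pairs `(i_0, j_0), …, (i_r, j_r)` in `S`, `r ≥ 0`, with
`j_t = i_{t+1}` for all `t`, indices being read cyclically (in `Fin (r + 1)`, `r + 1 = 0`). -/
def IsAdmissible {m : ℕ} (S : Finset (Fin m × Fin m)) : Prop :=
  (∀ p ∈ S, ∀ p' ∈ S, p.2 = p'.2 → p = p') ∧
  ∀ r : ℕ, ¬ ∃ c : Fin (r + 1) → Fin m × Fin m,
    Function.Injective c ∧ (∀ t, c t ∈ S) ∧ ∀ t, (c t).2 = (c (t + 1)).1

/-- The binomial coefficient `a(a-1)⋯(a-k+1)/k!` with an arbitrary upper entry. -/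
def genBinom {K : Type*} [Field K] (a : K) (k : ℕ) : K :=
  (∏ t ∈ Finset.range k, (a - (t : K))) / (k.factorial : K)

open Classical in
/-- The factor `A(l₁,…,l_m)`, for levels `n_j` in a field `K`. -/
noncomputable def factorA {K : Type*} [Field K] {m : ℕ} (C : Matrix (Fin m) (Fin m) ℤ)
    (n : Fin m → K) (l : Fin m →₀ ℕ) : K :=
  (∏ j, n j) *
    (1 + ∑ k ∈ Finset.Icc 1 (m - 1),
      ∑ S ∈ (Finset.powersetCard k (Finset.univ : Finset (Fin m × Fin m))).filter
        (fun S => IsAdmissible S),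
        ∏ p ∈ S, (C p.1 p.2 : K) * (l p.1 : K) * (n p.2)⁻¹)

/-- The expression `n_j + ∑_i C_{ij} l_i`. -/
def shiftedLevel {K : Type*} [Field K] {m : ℕ} (C : Matrix (Fin m) (Fin m) ℤ)
    (n : Fin m → K) (l : Fin m →₀ ℕ) (j : Fin m) : K :=
  n j + ∑ i, (C i j : K) * (l i : K)

/-- The explicit expression for `b_{l₁,…,l_m}`, for levels `n_j` in a field `K`. -/
noncomputable def coeffFormula {K : Type*} [Field K] {m : ℕ} (C : Matrix (Fin m) (Fin m) ℤ)
    (n : Fin m → K) (l : Fin m →₀ ℕ) : K :=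
  (-1 : K) ^ (∑ i, (C i i + 1) * (l i : ℤ)) * factorA C n l *
    ∏ j, (1 / shiftedLevel C n l j) * genBinom (shiftedLevel C n l j) (l j)

/-- The indeterminate `n_j`, as an element of the field `ℚ(n₁,…,n_m)` of rational functions. -/
noncomputable def levelVar {m : ℕ} (j : Fin m) : FractionRing (MvPolynomial (Fin m) ℚ) :=
  algebraMap (MvPolynomial (Fin m) ℚ) (FractionRing (MvPolynomial (Fin m) ℚ)) (MvPolynomial.X j)

/-! Both sides are compared with Good's determinant `goodCoeff`, a signed determinant of binomials
that is polynomial in the levels `n` and has no denominators. Analytic side: raising `n_j` by one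
changes `P_C(q^n x)` by a multiple of `x_j` times the same series at levels `n + C e_j`
(`rescale_add_single_sub`). As `q → 1` this becomes a recursion for the coefficients of the
quotient. Pascal's rule in row `j` gives `goodCoeff` the same recursion (`goodCoeff_add_single`),
and both equal the series `1` at `n = 0`. Induction on `l`, then unit steps in `n`, proves
`tendsto_coeff_intQuotient`. Levels range over `ℤ` because entries of `C` may be negative. Algebraic
side: for nonzero denominators, pulling `binom(s_j, l_j) / s_j` out of row `j`, with `s_j` the
shifted level, leaves a Laplacian-type determinant. The matrix-forest theorem
(`det_eq_sum_isAdmissible`) identifies it with the factor `A`. -/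

/-! ### Rooted forests and the matrix-forest theorem. -/

/-- The edges `(parent, child)` of a partial function `f` sending children to parents. -/
def parentEdges {m : ℕ} (f : Fin m → Option (Fin m)) : Finset (Fin m × Fin m) :=
  Finset.univ.filter fun p => f p.2 = some p.1

/-- The matrix with rows `e_j - e_{f j}`, where `e_{none} = 0`. -/
def parentMatrix (K : Type*) [Ring K] {m : ℕ} (f : Fin m → Option (Fin m)) :
    Matrix (Fin m) (Fin m) K :=
  Matrix.of fun j => Pi.single j 1 - (f j).elim 0 fun i => Pi.single i 1

lemma mem_parentEdges {m : ℕ} {f : Fin m → Option (Fin m)} {p : Fin m × Fin m} :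
    p ∈ parentEdges f ↔ f p.2 = some p.1 := by
  simp [parentEdges]

lemma parentEdges_snd_inj {m : ℕ} (f : Fin m → Option (Fin m)) :
    ∀ p ∈ parentEdges f, ∀ p' ∈ parentEdges f, p.2 = p'.2 → p = p' := by
  intro p hp p' hp' h
  rw [mem_parentEdges] at hp hp'
  rw [h, hp'] at hp
  exact Prod.ext (Option.some_injective _ hp).symm h

lemma parentMatrix_apply {K : Type*} [Ring K] {m : ℕ} (f : Fin m → Option (Fin m)) (j i : Fin m) :
    parentMatrix K f j i = (if j = i then 1 else 0) - (if f j = some i then 1 else 0) := by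
  rw [parentMatrix, Matrix.of_apply, Pi.sub_apply, Pi.single_apply]
  cases h : f j with
  | none => simp [eq_comm]
  | some k => simp [Pi.single_apply, eq_comm]

/-- An orbit of length `r + 1` of a permutation, read as a cycle of pairs. -/
lemma not_isAdmissible_of_perm {m : ℕ} {S : Finset (Fin m × Fin m)} (σ : Equiv.Perm (Fin m))
    (j : Fin m) (h : ∀ k : ℕ, ((σ^[k]) j, (σ^[k + 1]) j) ∈ S) : ¬ IsAdmissible S := by
  intro hS
  have hp : 0 < Function.minimalPeriod σ j :=
    Function.minimalPeriod_pos_of_mem_periodicPts (σ.injective.mem_periodicPts j)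
  obtain ⟨r, hr⟩ := Nat.exists_eq_succ_of_ne_zero hp.ne'
  refine hS.2 r ⟨fun t => ((σ^[(t : ℕ)]) j, (σ^[(t : ℕ) + 1]) j), ?_, fun t => h t, ?_⟩
  · intro s t hst
    have h1 : (σ^[(s : ℕ)]) j = (σ^[(t : ℕ)]) j := congrArg Prod.fst hst
    apply Fin.ext
    exact Function.iterate_injOn_Iio_minimalPeriod (f := σ) (x := j)
      (by rw [Set.mem_Iio, hr]; exact s.2) (by rw [Set.mem_Iio, hr]; exact t.2) h1
  · intro t
    show (σ^[(t : ℕ) + 1]) j = (σ^[((t + 1 : Fin (r + 1)) : ℕ)]) j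
    by_cases ht : t = Fin.last r
    · subst ht
      have := Function.iterate_minimalPeriod (f := σ) (x := j)
      rw [hr] at this
      simpa using this
    · rw [Fin.val_add_one, if_neg ht]

/-- A nonzero Leibniz term for `σ ≠ 1` forces `f (σ i) = some i` wherever `σ` moves `i`, so the
orbit of a moved point would be a cycle of edges. The identity term is `1` because there are no
loops. -/
lemma det_parentMatrix_of_isAdmissible {K : Type*} [Field K] {m : ℕ} {f : Fin m → Option (Fin m)}
    (hf : IsAdmissible (parentEdges f)) : (parentMatrix K f).det = 1 := by
  rw [Matrix.det_apply, Finset.sum_eq_single 1]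
  · have hloop : ∀ j, f j ≠ some j := by
      intro j hj
      refine not_isAdmissible_of_perm 1 j (fun k => ?_) hf
      rw [mem_parentEdges]
      simpa [Equiv.Perm.coe_one] using hj
    simp [parentMatrix_apply, hloop]
  · intro σ _ hσ
    obtain ⟨j, hj⟩ : ∃ j, σ j ≠ j := by
      by_contra! h
      exact hσ (Equiv.ext h)
    by_contra hne
    have hprod : ∀ i, parentMatrix K f (σ i) i ≠ 0 := by
      intro i hi
      have h0 : ∏ i, parentMatrix K f (σ i) i = 0 := Finset.prod_eq_zero (Finset.mem_univ i) hi
      exact hne ((congrArg _ h0).trans (smul_zero _))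
    refine not_isAdmissible_of_perm σ j (fun k => ?_) hf
    rw [mem_parentEdges]
    have hk := hprod ((σ^[k]) j)
    have hmove : σ ((σ^[k]) j) ≠ (σ^[k]) j := by
      rw [← Function.iterate_succ_apply' σ, Function.iterate_succ_apply σ]
      exact fun h => hj ((σ.injective.iterate k) h)
    rw [parentMatrix_apply, if_neg hmove] at hk
    show f ((σ^[k + 1]) j) = some ((σ^[k]) j)
    rw [Function.iterate_succ_apply' σ]
    by_contra hcon
    simp [hcon] at hk
  · simp

/-- The rows of the children along a cycle are `e_child - e_parent`, and their sum telescopes to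
zero. -/
lemma det_parentMatrix_of_not_isAdmissible {K : Type*} [Field K] [CharZero K] {m : ℕ}
    {f : Fin m → Option (Fin m)} (hf : ¬ IsAdmissible (parentEdges f)) :
    (parentMatrix K f).det = 0 := by
  have : ∃ r : ℕ, ∃ c : Fin (r + 1) → Fin m × Fin m,
      Function.Injective c ∧ (∀ t, c t ∈ parentEdges f) ∧ ∀ t, (c t).2 = (c (t + 1)).1 := by
    by_contra h
    exact hf ⟨parentEdges_snd_inj f, fun r hr => h ⟨r, hr⟩⟩
  obtain ⟨r, c, -, hc, hcyc⟩ := this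
  rw [← Matrix.exists_vecMul_eq_zero_iff]
  refine ⟨∑ t, Pi.single (c t).2 1, ?_, ?_⟩
  · intro h
    have h0 := congrFun h (c 0).2
    rw [Finset.sum_apply] at h0
    -- The entries of the vector are counts, so in characteristic zero the term `t = 0` prevents
    -- cancellation.
    have h1 : ∀ t, (Pi.single (c t).2 1 : Fin m → K) (c 0).2 =
        ((if (c 0).2 = (c t).2 then 1 else 0 : ℕ) : K) := by
      intro t
      simp [Pi.single_apply]
    simp_rw [h1] at h0
    rw [← Nat.cast_sum, Pi.zero_apply, Nat.cast_eq_zero, Finset.sum_eq_zero_iff] at h0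
    simpa using h0 0 (Finset.mem_univ _)
  · have hrow : ∀ t, Matrix.vecMul (Pi.single (c t).2 1) (parentMatrix K f) =
        Pi.single (c (t + 1)).1 1 - Pi.single (c t).1 1 := by
      intro t
      have := mem_parentEdges.1 (hc t)
      rw [Matrix.single_one_vecMul]
      funext i
      rw [Matrix.row_apply, parentMatrix_apply, this, Pi.sub_apply, Pi.single_apply,
        Pi.single_apply, ← hcyc t]
      simp [eq_comm]
    rw [Matrix.sum_vecMul, Finset.sum_congr rfl fun t _ => hrow t, Finset.sum_sub_distrib, sub_eq_zero]
    exact Equiv.sum_comp (Equiv.addRight (1 : Fin (r + 1)))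
      fun t => (Pi.single (c t).1 1 : Fin m → K)

/-- If every vertex had a parent, all row sums of the parent matrix would vanish, contradicting
determinant `1`. -/
lemma exists_eq_none_of_isAdmissible {m : ℕ} (hm : m ≠ 0) {f : Fin m → Option (Fin m)}
    (hf : IsAdmissible (parentEdges f)) : ∃ j, f j = none := by
  by_contra! h
  have h1 := det_parentMatrix_of_isAdmissible (K := ℚ) hf
  have h0 : (parentMatrix ℚ f).det = 0 := by
    rw [← Matrix.exists_mulVec_eq_zero_iff]
    refine ⟨fun _ => 1, fun hz => ?_, ?_⟩
    · simpa using congrFun hz ⟨0, Nat.pos_of_ne_zero hm⟩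
    · ext j
      obtain ⟨k, hk⟩ := Option.ne_none_iff_exists'.1 (h j)
      simp [Matrix.mulVec, dotProduct, parentMatrix_apply, hk]
  rw [h0] at h1
  exact zero_ne_one h1

lemma exists_parentEdges_eq {m : ℕ} {S : Finset (Fin m × Fin m)}
    (hS : ∀ p ∈ S, ∀ p' ∈ S, p.2 = p'.2 → p = p') : ∃ f, parentEdges f = S := by
  classical
  refine ⟨fun j => if h : ∃ i, (i, j) ∈ S then some h.choose else none, ?_⟩
  ext ⟨i, j⟩
  rw [mem_parentEdges]
  by_cases h : ∃ i, (i, j) ∈ S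
  · simp only [dif_pos h, Option.some.injEq]
    constructor
    · intro hi
      rw [← hi]
      exact h.choose_spec
    · intro hij
      exact congrArg Prod.fst (hS _ h.choose_spec _ hij rfl)
  · simp only [dif_neg h, reduceCtorEq, false_iff]
    exact fun hij => h ⟨i, hij⟩

lemma parentEdges_injective {m : ℕ} : Function.Injective (parentEdges (m := m)) := by
  intro f g h
  funext j
  apply Option.ext
  intro i
  have := Finset.ext_iff.1 h (i, j)
  rwa [mem_parentEdges, mem_parentEdges] at this

lemma prod_parentEdges {K : Type*} [CommRing K] {m : ℕ} (f : Fin m → Option (Fin m))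
    (w : Fin m × Fin m → K) :
    ∏ p ∈ parentEdges f, w p = ∏ j, (f j).elim 1 fun i => w (i, j) := by
  rw [parentEdges, Finset.prod_filter, Fintype.prod_prod_type_right]
  refine Finset.prod_congr rfl fun j _ => ?_
  cases h : f j with
  | none => simp [h]
  | some k => simp [h, Finset.prod_ite_eq]

/-- A root is never a second entry. Hence stopping at `k = m - 1` in `factorA` omits no admissible
set. -/
lemma IsAdmissible.card_lt {m : ℕ} (hm : m ≠ 0) {S : Finset (Fin m × Fin m)}
    (hS : IsAdmissible S) : S.card < m := by
  obtain ⟨f, rfl⟩ := exists_parentEdges_eq hS.1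
  obtain ⟨j, hj⟩ := exists_eq_none_of_isAdmissible hm hS
  have hsub : (parentEdges f).image Prod.snd ⊆ Finset.univ.erase j := by
    intro k hk
    obtain ⟨p, hp, rfl⟩ := Finset.mem_image.1 hk
    rw [mem_parentEdges] at hp
    refine Finset.mem_erase.2 ⟨?_, Finset.mem_univ _⟩
    rintro h
    rw [h, hj] at hp
    cases hp
  have hcard := Finset.card_le_card hsub
  rw [Finset.card_image_of_injOn fun p hp p' hp' h => parentEdges_snd_inj f p hp p' hp' h,
    Finset.card_erase_of_mem (Finset.mem_univ _), Finset.card_univ, Fintype.card_fin] at hcard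
  omega

lemma isAdmissible_empty {m : ℕ} : IsAdmissible (∅ : Finset (Fin m × Fin m)) :=
  ⟨by simp, fun _ ⟨_, _, h, _⟩ => by simpa using h 0⟩

open Classical in
lemma one_add_sum_isAdmissible {K : Type*} [CommRing K] {m : ℕ} (w : Fin m × Fin m → K) :
    1 + ∑ k ∈ Finset.Icc 1 (m - 1),
      ∑ S ∈ (Finset.powersetCard k (Finset.univ : Finset (Fin m × Fin m))).filter
        (fun S => IsAdmissible S), ∏ p ∈ S, w p =
    ∑ S : Finset (Fin m × Fin m), if IsAdmissible S then ∏ p ∈ S, w p else 0 := by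
  have hfib : ∀ S ∈ Finset.univ.filter (fun S : Finset (Fin m × Fin m) => IsAdmissible S),
      S.card ∈ Finset.Icc 0 (m - 1) := by
    intro S hS
    rw [Finset.mem_filter] at hS
    rw [Finset.mem_Icc]
    refine ⟨Nat.zero_le _, ?_⟩
    rcases eq_or_ne m 0 with rfl | hm
    -- For `m = 0` the truncated `m - 1` is `0`, and only the empty set exists.
    · simp [Finset.eq_empty_of_isEmpty S]
    · have := hS.2.card_lt hm
      omega
  rw [← Finset.sum_filter, ← Finset.sum_fiberwise_of_maps_to hfib,
    ← Finset.add_sum_Ioc_eq_sum_Icc (Nat.zero_le _)]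
  congr 1
  · rw [Finset.filter_filter, Finset.sum_eq_single ∅]
    · simp
    · intro S hS hne
      rw [Finset.mem_filter] at hS
      exact absurd (Finset.card_eq_zero.1 hS.2.2) hne
    · intro h
      exact absurd (by simp [isAdmissible_empty]) h
  · refine Finset.sum_congr rfl fun k _ => Finset.sum_congr ?_ fun _ _ => rfl
    ext S
    simp [Finset.mem_powersetCard, and_comm]

open Classical in
/-- The weighted matrix-forest theorem: a determinant whose row `j` is
`n_j e_j + ∑_i w_{ij} (e_j - e_i)` enumerates rooted forests. -/
lemma det_eq_sum_isAdmissible {K : Type*} [Field K] [CharZero K] {m : ℕ} (n : Fin m → K)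
    (hn : ∀ j, n j ≠ 0) (w : Fin m → Fin m → K) :
    (Matrix.of fun j k => (if j = k then n j + ∑ i, w i j else 0) - w k j).det =
      (∏ j, n j) * ∑ S : Finset (Fin m × Fin m),
        if IsAdmissible S then ∏ p ∈ S, w p.1 p.2 * (n p.2)⁻¹ else 0 := by
  have hrow : (Matrix.of fun j k => (if j = k then n j + ∑ i, w i j else 0) - w k j) =
      fun j => ∑ o : Option (Fin m), (o.elim (n j) fun i => w i j) •
        ((Pi.single j 1 - o.elim 0 fun i => Pi.single i 1 : Fin m → K)) := by
    funext j k
    rw [Fintype.sum_option]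
    simp [Finset.sum_apply, Pi.single_apply, mul_sub, Finset.sum_sub_distrib, eq_comm (a := k)]
    split_ifs <;> ring
  have hdet : (Matrix.of fun j k => (if j = k then n j + ∑ i, w i j else 0) - w k j).det =
      ∑ f : Fin m → Option (Fin m), (∏ j, (f j).elim (n j) fun i => w i j) *
        (parentMatrix K f).det := by
    rw [hrow]
    -- Expanding all rows at once chooses a root or a parent for each `j`, that is, a partial
    -- function `f`.
    refine (MultilinearMap.map_sum
      (Matrix.detRowAlternating (n := Fin m) (R := K)).toMultilinearMap _).trans ?_
    refine Finset.sum_congr rfl fun f _ => ?_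
    rw [MultilinearMap.map_smul_univ, smul_eq_mul]
    rfl
  rw [hdet, Finset.mul_sum]
  have hzero : ∀ S : Finset (Fin m × Fin m), S ∉ Set.range (parentEdges (m := m)) →
      (∏ j, n j) * (if IsAdmissible S then ∏ p ∈ S, w p.1 p.2 * (n p.2)⁻¹ else 0) = 0 := by
    intro S hS
    rw [if_neg, mul_zero]
    exact fun h => hS (exists_parentEdges_eq h.1)
  refine Fintype.sum_of_injective parentEdges parentEdges_injective _ _ hzero fun f => ?_
  split_ifs with hf
  · rw [det_parentMatrix_of_isAdmissible hf, mul_one, prod_parentEdges f fun p => w p.1 p.2 * (n p.2)⁻¹,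
      ← Finset.prod_mul_distrib]
    refine Finset.prod_congr rfl fun j _ => ?_
    cases f j with
    | none => simp
    | some i => simp only [Option.elim]; field_simp [hn j]
  · rw [det_parentMatrix_of_not_isAdmissible hf, mul_zero, mul_zero]

lemma factorA_eq_det {K : Type*} [Field K] [CharZero K] {m : ℕ} (C : Matrix (Fin m) (Fin m) ℤ)
    (n : Fin m → K) (hn : ∀ j, n j ≠ 0) (l : Fin m →₀ ℕ) :
    factorA C n l = (Matrix.of fun j k =>
      (if j = k then shiftedLevel C n l j else 0) - (C k j : K) * (l k : K)).det := by
  rw [factorA, one_add_sum_isAdmissible]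
  exact (det_eq_sum_isAdmissible n hn fun i j => (C i j : K) * (l i : K)).symm

/-! ### Binomial coefficients in a `ℚ`-algebra. -/

/-- The binomial coefficient `a(a-1)⋯(a-k+1)/k!` in a `ℚ`-algebra. -/
def ratBinom {R : Type*} [CommRing R] [Algebra ℚ R] (a : R) (k : ℕ) : R :=
  algebraMap ℚ R (k.factorial : ℚ)⁻¹ * ∏ t ∈ Finset.range k, (a - (t : R))

/-- The binomial coefficient `binom (a - 1) (k - 1)`, which is `0` for `k = 0`. -/
def ratBinomPred {R : Type*} [CommRing R] [Algebra ℚ R] (a : R) : ℕ → R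
  | 0 => 0
  | k + 1 => ratBinom (a - 1) k

section Binomial

variable {R : Type*} [CommRing R] [Algebra ℚ R]

@[simp] lemma ratBinom_zero (a : R) : ratBinom a 0 = 1 := by simp [ratBinom]

@[simp] lemma ratBinomPred_zero (a : R) : ratBinomPred a 0 = 0 := rfl

lemma algebraMap_inv_factorial_succ (k : ℕ) :
    ((k + 1 : ℕ) : R) * algebraMap ℚ R ((k + 1).factorial : ℚ)⁻¹ =
      algebraMap ℚ R (k.factorial : ℚ)⁻¹ := by
  rw [← map_natCast (algebraMap ℚ R), ← map_mul, Nat.factorial_succ]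
  congr 1
  have : (k.factorial : ℚ) ≠ 0 := by exact_mod_cast k.factorial_ne_zero
  push_cast
  field_simp

lemma succ_mul_ratBinom_succ (a : R) (k : ℕ) :
    ((k + 1 : ℕ) : R) * ratBinom a (k + 1) = (a - k) * ratBinom a k := by
  rw [ratBinom, ratBinom, ← mul_assoc, algebraMap_inv_factorial_succ, Finset.prod_range_succ]
  ring

/-- This absorption identity gives both the vanishing of Good's determinant at level `0` and the
passage to the formula with denominators. -/
lemma natCast_mul_ratBinom (a : R) (k : ℕ) :
    (k : R) * ratBinom a k = a * ratBinomPred a k := by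
  cases k with
  | zero => simp
  | succ k =>
    rw [ratBinomPred, ratBinom, ratBinom, ← mul_assoc, algebraMap_inv_factorial_succ,
      Finset.prod_range_succ']
    have : ∀ t ∈ Finset.range k, a - ((t + 1 : ℕ) : R) = a - 1 - t := by
      intro t _
      push_cast
      ring
    rw [Finset.prod_congr rfl this]
    push_cast
    ring

lemma ratBinom_add_one (a : R) (k : ℕ) :
    ratBinom (a + 1) (k + 1) = ratBinom a (k + 1) + ratBinom a k := by
  have hu : IsUnit ((k + 1 : ℕ) : R) := by
    rw [← map_natCast (algebraMap ℚ R)]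
    exact (IsUnit.mk0 _ (by positivity)).map _
  apply hu.mul_left_cancel
  rw [natCast_mul_ratBinom, mul_add, succ_mul_ratBinom_succ, ratBinomPred, add_sub_cancel_right]
  push_cast
  ring

lemma ratBinomPred_add_one (a : R) (k : ℕ) :
    ratBinomPred (a + 1) (k + 1) = ratBinomPred a (k + 1) + ratBinomPred a k := by
  cases k with
  | zero => simp [ratBinomPred]
  | succ k =>
    rw [ratBinomPred, ratBinomPred, ratBinomPred, ← ratBinom_add_one]
    ring_nf

lemma map_ratBinom {S : Type*} [CommRing S] [Algebra ℚ S] (φ : R →+* S) (a : R) (k : ℕ) :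
    φ (ratBinom a k) = ratBinom (φ a) k := by
  have h : φ (algebraMap ℚ R (k.factorial : ℚ)⁻¹) = algebraMap ℚ S (k.factorial : ℚ)⁻¹ := by
    rw [← RingHom.comp_apply]
    exact RingHom.congr_fun (Subsingleton.elim _ _) _
  simp [ratBinom, h, map_prod]

lemma map_ratBinomPred {S : Type*} [CommRing S] [Algebra ℚ S] (φ : R →+* S) (a : R) (k : ℕ) :
    φ (ratBinomPred a k) = ratBinomPred (φ a) k := by
  cases k with
  | zero => simp
  | succ k => simp [ratBinomPred, map_ratBinom]

lemma ratBinom_eq_genBinom {K : Type*} [Field K] [Algebra ℚ K] (a : K) (k : ℕ) :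
    ratBinom a k = genBinom a k := by
  rw [ratBinom, genBinom, map_inv₀, map_natCast, div_eq_inv_mul]

end Binomial

/-! ### Good's determinant and its recursion in the levels. -/

section Good

variable {R : Type*} [CommRing R] [Algebra ℚ R] {ι : Type*} [Fintype ι] [DecidableEq ι]

/-- The matrix with entries `δ_{ij} binom(a_i, l_i) - C_{ij} binom(a_i - 1, l_i - 1)`, whose
determinant is the coefficient in Good's Lagrange inversion formula. -/
def goodMatrix (C : Matrix ι ι ℤ) (a : ι → R) (l : ι → ℕ) : Matrix ι ι R :=
  Matrix.of fun i j =>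
    (if i = j then ratBinom (a i) (l i) else 0) - (C i j : R) * ratBinomPred (a i) (l i)

/-- Good's coefficient of `x^l` for the levels `n`. -/
def goodCoeff (C : Matrix ι ι ℤ) (n : ι → R) (l : ι → ℕ) : R :=
  (((-1 : ℤˣ) ^ (∑ i, (C i i + 1) * (l i : ℤ)) : ℤˣ) : ℤ) *
    (goodMatrix C (fun i => n i + ∑ j, (C i j : R) * (l j : R)) l).det

lemma map_goodCoeff {S : Type*} [CommRing S] [Algebra ℚ S] (φ : R →+* S) (C : Matrix ι ι ℤ)
    (n : ι → R) (l : ι → ℕ) : φ (goodCoeff C n l) = goodCoeff C (fun i => φ (n i)) l := by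
  rw [goodCoeff, goodCoeff, map_mul, map_intCast, RingHom.map_det]
  congr 2
  ext i j
  simp [goodMatrix, map_ratBinom, map_ratBinomPred, apply_ite φ]

lemma goodCoeff_zero_right (C : Matrix ι ι ℤ) (n : ι → R) : goodCoeff C n 0 = 1 := by
  have : goodMatrix C (fun i => n i + ∑ j, (C i j : R) * (((0 : ι → ℕ) j : ℕ) : R)) 0 = 1 := by
    ext i j
    simp [goodMatrix, Matrix.one_apply]
  rw [goodCoeff, this]
  simp

/-- At level `0` one has `a = C l`, and by absorption the nonzero vector `l` lies in the kernel of
the matrix. -/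
lemma goodCoeff_zero_left [IsDomain R] (C : Matrix ι ι ℤ) {l : ι → ℕ} (hl : l ≠ 0) :
    goodCoeff C (0 : ι → R) l = 0 := by
  have : CharZero R := algebraRat.charZero R
  rw [goodCoeff, Matrix.exists_mulVec_eq_zero_iff.1, mul_zero]
  refine ⟨fun i => (l i : R), fun h => hl ?_, ?_⟩
  · funext i
    simpa using congrFun h i
  · funext i
    simp only [Matrix.mulVec, dotProduct, goodMatrix, Matrix.of_apply, sub_mul,
      Finset.sum_sub_distrib, ite_mul, zero_mul, Finset.sum_ite_eq, Finset.mem_univ, if_true,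
      Pi.zero_apply, zero_add]
    rw [mul_comm, natCast_mul_ratBinom, Finset.sum_mul, sub_eq_zero]
    exact Finset.sum_congr rfl fun j _ => by ring

/-- When `l_j = 0`, row `j` is a unit vector and does not see the level `n_j`. -/
lemma goodCoeff_add_single_of_eq_zero (C : Matrix ι ι ℤ) (n : ι → R) {l : ι → ℕ} {j : ι}
    (hj : l j = 0) : goodCoeff C (n + Pi.single j 1) l = goodCoeff C n l := by
  rw [goodCoeff, goodCoeff]
  congr 2
  ext i k
  by_cases hi : i = j
  · subst hi
    simp [goodMatrix, hj]
  · simp [goodMatrix, hi]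

/-- Levels `n` at `l + e_j` and levels `n + C e_j` at `l` give the same upper entries `a`. The three
matrices differ only in row `j`, where Pascal's rule makes one row the sum of the other two. The
sign comes from the exponent growing by `C_jj + 1`. -/
lemma goodCoeff_add_single (C : Matrix ι ι ℤ) (n : ι → R) (l : ι → ℕ) (j : ι) :
    goodCoeff C (n + Pi.single j 1) (l + Pi.single j 1) =
      goodCoeff C n (l + Pi.single j 1) -
        (((-1 : ℤˣ) ^ C j j : ℤˣ) : ℤ) * goodCoeff C (n + fun i => (C i j : R)) l := by
  have hsum : ∀ i, (∑ k, (C i k : R) * (((l + Pi.single j 1 : ι → ℕ) k : ℕ) : R)) =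
      ∑ k, (C i k : R) * (l k : R) + C i j := by
    intro i
    simp [mul_add, Finset.sum_add_distrib, Pi.single_apply]
  have hsign : ∑ i, (C i i + 1) * (((l + Pi.single j 1 : ι → ℕ) i : ℕ) : ℤ) =
      ∑ i, (C i i + 1) * (l i : ℤ) + (C j j + 1) := by
    simp [mul_add, Finset.sum_add_distrib, Pi.single_apply]
  set a : ι → R := fun i => n i + C i j + ∑ k, (C i k : R) * (l k : R) with ha
  have h1 : (fun i => n i + ∑ k, (C i k : R) * (((l + Pi.single j 1 : ι → ℕ) k : ℕ) : R)) = a := by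
    funext i
    rw [hsum, ha]
    ring
  have h2 : (fun i => (n + Pi.single j 1 : ι → R) i +
      ∑ k, (C i k : R) * (((l + Pi.single j 1 : ι → ℕ) k : ℕ) : R)) = a + Pi.single j 1 := by
    funext i
    rw [hsum, ha]
    simp only [Pi.add_apply]
    ring
  have h3 : (fun i => (n + fun i => (C i j : R)) i + ∑ k, (C i k : R) * (l k : R)) = a := rfl
  have hdet : (goodMatrix C (a + Pi.single j 1) (l + Pi.single j 1)).det =
      (goodMatrix C a (l + Pi.single j 1)).det + (goodMatrix C a l).det := by
    have e1 : goodMatrix C (a + Pi.single j 1) (l + Pi.single j 1) =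
        (goodMatrix C a l).updateRow j
          (goodMatrix C a (l + Pi.single j 1) j + goodMatrix C a l j) := by
      ext i k
      by_cases hi : i = j
      · subst hi
        rw [Matrix.updateRow_self]
        simp only [goodMatrix, Matrix.of_apply, Pi.add_apply, Pi.single_eq_same, ratBinom_add_one,
          ratBinomPred_add_one]
        split_ifs <;> ring
      · rw [Matrix.updateRow_ne hi]
        simp [goodMatrix, hi]
    have e2 : goodMatrix C a (l + Pi.single j 1) =
        (goodMatrix C a l).updateRow j (goodMatrix C a (l + Pi.single j 1) j) := by
      ext i k
      by_cases hi : i = j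
      · subst hi
        rw [Matrix.updateRow_self]
      · rw [Matrix.updateRow_ne hi]
        simp [goodMatrix, hi]
    rw [e1, Matrix.det_updateRow_add, ← e2, Matrix.updateRow_eq_self]
  rw [goodCoeff, goodCoeff, goodCoeff, h1, h2, h3, hdet, hsign, zpow_add, zpow_add]
  push_cast
  simp
  ring

end Good

/-! ### Good's determinant against the explicit formula. -/

lemma coeffFormula_eq_goodCoeff {K : Type*} [Field K] [Algebra ℚ K] {m : ℕ}
    {C : Matrix (Fin m) (Fin m) ℤ} (hC : C.IsSymm) (n : Fin m → K) (hn : ∀ j, n j ≠ 0)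
    (l : Fin m →₀ ℕ) (hl : ∀ j, shiftedLevel C n l j ≠ 0) :
    coeffFormula C n l = goodCoeff C n l := by
  have : CharZero K := algebraRat.charZero K
  have hshift : (fun i => n i + ∑ j, (C i j : K) * (l j : K)) = shiftedLevel C n l := by
    funext i
    rw [shiftedLevel]
    congr 1
    exact Finset.sum_congr rfl fun j _ => by rw [hC.apply]
  -- Absorption makes `binom(s_j, l_j) / s_j` a common factor of row `j`; the transposed forest
  -- matrix remains.
  have hmat : goodMatrix C (shiftedLevel C n l) l = Matrix.of fun j k =>
      (1 / shiftedLevel C n l j * genBinom (shiftedLevel C n l j) (l j)) *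
        (Matrix.of fun j k =>
          (if j = k then shiftedLevel C n l j else 0) - (C k j : K) * (l k : K)).transpose j k := by
    ext j k
    have h := natCast_mul_ratBinom (shiftedLevel C n l j) (l j)
    have hj := hl j
    rw [ratBinom_eq_genBinom] at h
    have hp : ratBinomPred (shiftedLevel C n l j) (l j) =
        (l j : K) * genBinom (shiftedLevel C n l j) (l j) / shiftedLevel C n l j := by
      rw [h]
      field_simp
    simp only [goodMatrix, Matrix.of_apply, Matrix.transpose_apply, hp, ratBinom_eq_genBinom]
    by_cases hjk : j = k
    · subst hjk
      simp only [if_true]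
      field_simp
    · rw [if_neg hjk, if_neg (Ne.symm hjk)]
      field_simp
      ring
  rw [coeffFormula, factorA_eq_det C n hn, goodCoeff, hshift, hmat, Matrix.det_mul_column,
    Matrix.det_transpose]
  have hsign : ((((-1 : ℤˣ) ^ (∑ i, (C i i + 1) * (l i : ℤ)) : ℤˣ) : ℤ) : K) =
      (-1 : K) ^ (∑ i, (C i i + 1) * (l i : ℤ)) := by
    rcases Int.even_or_odd (∑ i, (C i i + 1) * (l i : ℤ)) with h | h
    · simp [h.neg_one_zpow]
    · simp [h.neg_one_zpow]
  rw [hsign]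
  ring

/-! ### The `q`-difference equation and its limit. -/

section QuiverSeries

variable {m : ℕ} (C : Matrix (Fin m) (Fin m) ℤ)

lemma coeff_quiverSeries (q : ℝ) (d : Fin m →₀ ℕ) :
    MvPowerSeries.coeff d (quiverSeries C q) =
      (-Real.sqrt q) ^ (∑ i, ∑ j, C i j * (d i : ℤ) * (d j : ℤ)) / ∏ i, qPoch q (d i) := rfl

lemma constantCoeff_quiverSeries (q : ℝ) :
    MvPowerSeries.constantCoeff (quiverSeries C q) = 1 := by
  rw [← MvPowerSeries.coeff_zero_eq_constantCoeff_apply, coeff_quiverSeries]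
  simp [qPoch]

/-- The quotient `P_C(q^{n₁} x₁,…,q^{n_m} x_m) / P_C(x₁,…,x_m)` for integer levels. -/
noncomputable def intQuotient (n : Fin m → ℤ) (q : ℝ) : MvPowerSeries (Fin m) ℝ :=
  MvPowerSeries.rescale (fun i => q ^ n i) (quiverSeries C q) * (quiverSeries C q)⁻¹

lemma intQuotient_zero (q : ℝ) : intQuotient C 0 q = 1 := by
  have h : (fun i => q ^ (0 : Fin m → ℤ) i) = 1 := by
    funext i
    simp
  rw [intQuotient, h, MvPowerSeries.rescale_one, RingHom.id_apply,
    MvPowerSeries.mul_inv_cancel _ (by rw [constantCoeff_quiverSeries]; exact one_ne_zero)]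

lemma prod_qPoch_add_single (q : ℝ) (d : Fin m →₀ ℕ) (j : Fin m) :
    ∏ i, qPoch q ((d + Finsupp.single j 1 : Fin m →₀ ℕ) i) =
      (∏ i, qPoch q (d i)) * (1 - q ^ (d j + 1)) := by
  rw [← Finset.mul_prod_erase _ _ (Finset.mem_univ j),
    ← Finset.mul_prod_erase _ (fun i => qPoch q (d i)) (Finset.mem_univ j)]
  have h : ∀ i ∈ Finset.univ.erase j,
      qPoch q ((d + Finsupp.single j 1 : Fin m →₀ ℕ) i) = qPoch q (d i) := by
    intro i hi
    simp [(Finset.ne_of_mem_erase hi).symm]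
  rw [Finset.prod_congr rfl h]
  simp only [Finsupp.add_apply, Finsupp.single_eq_same, qPoch, Finset.prod_range_succ]
  ring

variable {C}

lemma quadForm_add_single (hC : C.IsSymm) (d : Fin m →₀ ℕ) (j : Fin m) :
    (∑ i, ∑ k, C i k *
      (((d + Finsupp.single j 1 : Fin m →₀ ℕ) i : ℕ) : ℤ) *
      (((d + Finsupp.single j 1 : Fin m →₀ ℕ) k : ℕ) : ℤ)) =
      (∑ i, ∑ k, C i k * (d i : ℤ) * (d k : ℤ)) + 2 * (∑ i, C i j * (d i : ℤ)) + C j j := by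
  have h : ∀ i k, C i k * (((d + Finsupp.single j 1 : Fin m →₀ ℕ) i : ℕ) : ℤ) *
      (((d + Finsupp.single j 1 : Fin m →₀ ℕ) k : ℕ) : ℤ) =
      C i k * (d i : ℤ) * (d k : ℤ) + (if j = k then C i k * (d i : ℤ) else 0) +
        ((if j = i then C i k * (d k : ℤ) else 0) + if j = k then if j = i then C i k else 0 else 0) := by
    intro i k
    simp only [Finsupp.add_apply, Finsupp.single_apply]
    split_ifs <;> push_cast <;> ring
  simp only [h, Finset.sum_add_distrib, Finset.sum_ite_eq, Finset.mem_univ, if_true]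
  rw [Finset.sum_comm (f := fun i k => if j = i then C i k * (d k : ℤ) else 0)]
  simp only [Finset.sum_ite_eq, Finset.mem_univ, if_true]
  simp only [hC.apply]
  ring

lemma finsupp_prod_zpow_pow {q : ℝ} (hq : q ≠ 0) (n : Fin m → ℤ) (d : Fin m →₀ ℕ) :
    (d.prod fun i k => (q ^ n i) ^ k) = q ^ ∑ i, n i * (d i : ℤ) := by
  rw [Finsupp.prod_fintype _ _ (fun i => pow_zero _)]
  simp_rw [← zpow_natCast, ← zpow_mul]
  induction (Finset.univ : Finset (Fin m)) using Finset.induction_on with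
  | empty => simp
  | insert i s hi ih => rw [Finset.prod_insert hi, Finset.sum_insert hi, zpow_add₀ hq, ih]

/-- The factor `q^{d_j} - 1` cancels the last factor of `(q;q)_{d_j}`. Lowering `d_j` by one changes
the quadratic form by a linear form, which acts as the level shift `C e_j`, plus the constant
`C_jj`. -/
lemma rescale_add_single_sub (hC : C.IsSymm) (n : Fin m → ℤ) (j : Fin m) {q : ℝ} (hq : 0 < q)
    (hq1 : q ≠ 1) :
    MvPowerSeries.rescale (fun i => q ^ (n + Pi.single j 1 : Fin m → ℤ) i) (quiverSeries C q) -
        MvPowerSeries.rescale (fun i => q ^ n i) (quiverSeries C q) =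
      MvPowerSeries.monomial (Finsupp.single j 1) (-(q ^ n j * (-Real.sqrt q) ^ C j j)) *
        MvPowerSeries.rescale (fun i => q ^ (n i + C i j)) (quiverSeries C q) := by
  ext d
  rw [map_sub, MvPowerSeries.coeff_rescale, MvPowerSeries.coeff_rescale,
    finsupp_prod_zpow_pow hq.ne', finsupp_prod_zpow_pow hq.ne', MvPowerSeries.coeff_monomial_mul]
  have hexp : ∑ i, (n + Pi.single j 1 : Fin m → ℤ) i * (d i : ℤ) =
      ∑ i, n i * (d i : ℤ) + (d j : ℤ) := by
    simp [add_mul, Finset.sum_add_distrib, Pi.single_apply]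
  rw [hexp]
  by_cases hd : Finsupp.single j 1 ≤ d
  · obtain ⟨e, rfl⟩ := exists_add_of_le hd
    rw [if_pos hd, add_tsub_cancel_left, add_comm _ e, MvPowerSeries.coeff_rescale,
      finsupp_prod_zpow_pow hq.ne', coeff_quiverSeries, coeff_quiverSeries, quadForm_add_single hC,
      prod_qPoch_add_single]
    have hs : -Real.sqrt q ≠ 0 := neg_ne_zero.2 (Real.sqrt_pos.2 hq).ne'
    have h1 : ∑ i, n i * (((e + Finsupp.single j 1 : Fin m →₀ ℕ) i : ℕ) : ℤ) = ∑ i, n i * (e i : ℤ) + n j := by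
      simp [mul_add, Finset.sum_add_distrib, Finsupp.single_apply]
    have h2 : ∑ i, (n i + C i j) * (e i : ℤ) = ∑ i, n i * (e i : ℤ) + ∑ i, C i j * (e i : ℤ) := by
      simp [add_mul, Finset.sum_add_distrib]
    have h3 : (1 : ℝ) - q ^ (e j + 1) ≠ 0 := by
      rw [sub_ne_zero]
      intro h
      exact hq1 ((pow_eq_one_iff_of_nonneg hq.le (Nat.succ_ne_zero _)).1 h.symm)
    have h4 : (-Real.sqrt q) ^ (2 : ℤ) = q := by
      rw [zpow_ofNat, neg_sq, Real.sq_sqrt hq.le]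
    have h5 : (((e + Finsupp.single j 1 : Fin m →₀ ℕ) j : ℕ) : ℤ) = ((e j + 1 : ℕ) : ℤ) := by simp
    rw [h1, h2, h5, zpow_add₀ hs, zpow_add₀ hs, zpow_mul, h4, zpow_add₀ hq.ne', zpow_add₀ hq.ne',
      zpow_add₀ hq.ne', zpow_natCast, div_mul_eq_div_div]
    field_simp
    ring
  · have hdj : d j = 0 := by
      by_contra h
      exact hd (Finsupp.single_le_iff.2 (Nat.one_le_iff_ne_zero.2 h))
    rw [if_neg hd, hdj]
    simp

lemma coeff_intQuotient_add_single (hC : C.IsSymm) (n : Fin m → ℤ) (j : Fin m) {q : ℝ}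
    (hq : 0 < q) (hq1 : q ≠ 1) (l : Fin m →₀ ℕ) :
    MvPowerSeries.coeff l (intQuotient C (n + Pi.single j 1) q) -
        MvPowerSeries.coeff l (intQuotient C n q) =
      if Finsupp.single j 1 ≤ l then -(q ^ n j * (-Real.sqrt q) ^ C j j) *
        MvPowerSeries.coeff (l - Finsupp.single j 1) (intQuotient C (n + fun i => C i j) q)
      else 0 := by
  rw [← MvPowerSeries.coeff_monomial_mul, ← map_sub, intQuotient, intQuotient, ← sub_mul,
    rescale_add_single_sub hC n j hq hq1, mul_assoc]
  rfl

lemma tendsto_sub_coeff_intQuotient (hC : C.IsSymm) (l : Fin m →₀ ℕ)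
    (ih : ∀ l' : Fin m →₀ ℕ, l' < l → ∀ n : Fin m → ℤ,
      Filter.Tendsto (fun q => MvPowerSeries.coeff l' (intQuotient C n q)) (𝓝[≠] 1)
        (𝓝 (goodCoeff C (fun i => (n i : ℝ)) l'))) (n : Fin m → ℤ) (j : Fin m) :
    Filter.Tendsto (fun q => MvPowerSeries.coeff l (intQuotient C (n + Pi.single j 1) q) -
        MvPowerSeries.coeff l (intQuotient C n q)) (𝓝[≠] 1)
      (𝓝 (goodCoeff C (fun i => ((n + Pi.single j 1 : Fin m → ℤ) i : ℝ)) l -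
        goodCoeff C (fun i => (n i : ℝ)) l)) := by
  have hcast : (fun i => ((n + Pi.single j 1 : Fin m → ℤ) i : ℝ)) =
      (fun i => (n i : ℝ)) + Pi.single j 1 := by
    funext i
    simp [Pi.single_apply, apply_ite (Int.cast : ℤ → ℝ)]
  have hev : ∀ᶠ q : ℝ in 𝓝[≠] 1, 0 < q ∧ q ≠ 1 :=
    (eventually_nhdsWithin_of_eventually_nhds (eventually_gt_nhds one_pos)).and
      eventually_mem_nhdsWithin
  rw [hcast]
  by_cases hl : Finsupp.single j 1 ≤ l
  · obtain ⟨e, rfl⟩ := exists_add_of_le hl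
    rw [add_comm _ e] at ih ⊢
    have hlt : e < e + Finsupp.single j 1 := lt_add_of_pos_right _ (by
      rw [pos_iff_ne_zero]
      simp)
    have hlim := ih e hlt (n + fun i => C i j)
    have hq : Filter.Tendsto (fun q : ℝ => -(q ^ n j * (-Real.sqrt q) ^ C j j)) (𝓝[≠] 1)
        (𝓝 (-((1 : ℝ) ^ n j * (-Real.sqrt 1) ^ C j j))) := by
      apply Filter.Tendsto.mono_left _ nhdsWithin_le_nhds
      exact (((continuousAt_id.zpow₀ _ (Or.inl one_ne_zero)).mul
        (Real.continuous_sqrt.neg.continuousAt.zpow₀ _ (Or.inl (by simp)))).neg).tendsto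
    have hgood := goodCoeff_add_single C (fun i => (n i : ℝ)) e j
    -- At `q = 1` the prefactor becomes `-(-1)^{C_jj}`, as in Good's recursion.
    have hval : goodCoeff C ((fun i => (n i : ℝ)) + Pi.single j 1) (e + Finsupp.single j 1 : Fin m →₀ ℕ) -
        goodCoeff C (fun i => (n i : ℝ)) (e + Finsupp.single j 1 : Fin m →₀ ℕ) =
        -((1 : ℝ) ^ n j * (-Real.sqrt 1) ^ C j j) *
          goodCoeff C (fun i => ((n + fun i => C i j : Fin m → ℤ) i : ℝ)) e := by
      have hfun : (fun i => ((n + fun i => C i j : Fin m → ℤ) i : ℝ)) =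
          (fun i => (n i : ℝ)) + fun i => (C i j : ℝ) := by
        funext i
        simp
      have hsign : ((((-1 : ℤˣ) ^ C j j : ℤˣ) : ℤ) : ℝ) = (-1 : ℝ) ^ C j j := by
        rcases Int.even_or_odd (C j j) with h | h
        · simp [h.neg_one_zpow]
        · simp [h.neg_one_zpow]
      rw [Finsupp.coe_add, Finsupp.single_eq_pi_single, hgood, hfun, hsign, Real.sqrt_one, one_zpow]
      ring
    rw [hval]
    refine (hq.mul hlim).congr' ?_
    filter_upwards [hev] with q hq'
    rw [coeff_intQuotient_add_single hC n j hq'.1 hq'.2, if_pos (by simp), add_tsub_cancel_right]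
  · have hlj : l j = 0 := by
      by_contra h
      exact hl (Finsupp.single_le_iff.2 (Nat.one_le_iff_ne_zero.2 h))
    rw [goodCoeff_add_single_of_eq_zero C _ hlj, sub_self]
    refine tendsto_const_nhds.congr' ?_
    filter_upwards [hev] with q hq'
    rw [coeff_intQuotient_add_single hC n j hq'.1 hq'.2, if_neg hl]

lemma tendsto_coeff_intQuotient (hC : C.IsSymm) (l : Fin m →₀ ℕ) (n : Fin m → ℤ) :
    Filter.Tendsto (fun q => MvPowerSeries.coeff l (intQuotient C n q)) (𝓝[≠] 1)
      (𝓝 (goodCoeff C (fun i => (n i : ℝ)) l)) := by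
  induction l using WellFoundedLT.induction generalizing n with
  | ind l ih =>
  set T : (Fin m → ℤ) → Prop := fun n =>
    Filter.Tendsto (fun q => MvPowerSeries.coeff l (intQuotient C n q)) (𝓝[≠] 1)
      (𝓝 (goodCoeff C (fun i => (n i : ℝ)) l)) with hT
  have hdiff := tendsto_sub_coeff_intQuotient hC l ih
  -- The difference of neighbouring levels converges by induction on `l`, so convergence passes both
  -- ways and reaches every integer level from `0`.
  have hstep : ∀ n j, T (n + Pi.single j 1) ↔ T n := by
    intro n j
    constructor
    · intro h
      simpa [hT] using h.sub (hdiff n j)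
    · intro h
      simpa [hT] using h.add (hdiff n j)
  have hzero : T 0 := by
    simp only [hT, intQuotient_zero]
    by_cases hl : l = 0
    · subst hl
      simp [goodCoeff_zero_right]
    · have h0 : (fun i => (((0 : Fin m → ℤ) i : ℤ) : ℝ)) = 0 := by
        funext i
        simp
      have hl' : (l : Fin m → ℕ) ≠ 0 := fun h => hl (DFunLike.coe_injective h)
      rw [h0, goodCoeff_zero_left C hl', MvPowerSeries.coeff_one, if_neg hl]
      exact tendsto_const_nhds
  have hadd : ∀ v n : Fin m → ℤ, T n → T (n + v) := by
    intro v
    induction v using Pi.single_induction with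
    | zero => simp
    | add f g hf hg =>
      intro n hn
      rw [← add_assoc]
      exact hg _ (hf _ hn)
    | single j k =>
      intro n hn
      induction k using Int.induction_on with
      | zero => simpa using hn
      | succ k ih => rwa [Pi.single_add, ← add_assoc, hstep]
      | pred k ih => rwa [← hstep _ j, add_assoc, ← Pi.single_add, sub_add_cancel]
  simpa using hadd n 0 hzero

end QuiverSeries

/-! ### Indeterminate levels and the conclusion. -/

lemma shiftedLevel_levelVar_ne_zero {m : ℕ} (C : Matrix (Fin m) (Fin m) ℤ) (l : Fin m →₀ ℕ)
    (j : Fin m) : shiftedLevel C levelVar l j ≠ 0 := by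
  have h : shiftedLevel C levelVar l j =
      algebraMap (MvPolynomial (Fin m) ℚ) (FractionRing (MvPolynomial (Fin m) ℚ))
        (MvPolynomial.X j + MvPolynomial.C (∑ i, (C i j : ℚ) * (l i : ℚ))) := by
    simp [shiftedLevel, levelVar]
  rw [h, Ne, FaithfulSMul.algebraMap_eq_zero_iff]
  intro h0
  have h1 := congrArg (MvPolynomial.coeff (Finsupp.single j 1)) h0
  have hne : (0 : Fin m →₀ ℕ) ≠ Finsupp.single j 1 := by
    intro h
    simpa using DFunLike.congr_fun h j
  rw [MvPolynomial.coeff_add, MvPolynomial.coeff_C, if_neg hne] at h1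
  simp at h1

/-- The polynomial `B l` is the value of the explicit formula once the levels are treated as
indeterminates and all cancellations are performed; the levels are substituted afterwards. If no
denominator of the formula vanishes, it can be evaluated directly. -/
theorem proposition1 (m : ℕ) (C : Matrix (Fin m) (Fin m) ℤ) (hC : C.IsSymm) :
    ∃ B : (Fin m →₀ ℕ) → MvPolynomial (Fin m) ℚ,
      (∀ l : Fin m →₀ ℕ,
        algebraMap (MvPolynomial (Fin m) ℚ) (FractionRing (MvPolynomial (Fin m) ℚ)) (B l) =
          coeffFormula C levelVar l) ∧
      ∀ n : Fin m → ℕ, ∃ y : MvPowerSeries (Fin m) ℝ,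
        IsClassicalLimit C n y ∧
        (∀ l : Fin m →₀ ℕ,
          MvPowerSeries.coeff l y = ((MvPolynomial.eval (fun j => (n j : ℚ)) (B l) : ℚ) : ℝ)) ∧
        ∀ l : Fin m →₀ ℕ, (∀ j, n j ≠ 0) →
          (∀ j, shiftedLevel C (fun j => (n j : ℝ)) l j ≠ 0) →
          MvPowerSeries.coeff l y = coeffFormula C (fun j => (n j : ℝ)) l := by
  -- Good's determinant at the variables is already a polynomial; its images in `ℚ(n)` and `ℝ` are
  -- again Good's determinants.
  refine ⟨fun l => goodCoeff C MvPolynomial.X l, fun l => ?_, fun n =>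
    ⟨fun l => goodCoeff C (fun j => (n j : ℝ)) l, fun l => ?_, fun l => ?_, fun l hn hl => ?_⟩⟩
  · rw [map_goodCoeff, coeffFormula_eq_goodCoeff hC _ (fun j => ?_) l
      (shiftedLevel_levelVar_ne_zero C l)]
    · rfl
    · rw [levelVar, Ne, FaithfulSMul.algebraMap_eq_zero_iff]
      exact MvPolynomial.X_ne_zero j
  · have h := tendsto_coeff_intQuotient hC l fun i => (n i : ℤ)
    simp only [intQuotient, zpow_natCast, Int.cast_natCast] at h
    exact h
  · rw [← eq_ratCast (algebraMap ℚ ℝ), map_goodCoeff, map_goodCoeff]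
    simp
    rfl
  · rw [coeffFormula_eq_goodCoeff hC _ (fun j => Nat.cast_ne_zero.2 (hn j)) l hl]
    rfl
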